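/- Let $f$ be a real- or complex-valued, locally integrable function on $(-1,1)$ whose derivative $\frac{df}{dt}$, understood in the weak (distributional) sense, is integrable on $(-1,1)$. (This includes every $f$ that is absolutely continuous on $[-1,1]$, and every $f$ that is differentiable on $(-1,1)$ with integrable derivative.) Let $P_n$ denote the $n$-th Legendre polynomial, $$P_n(t)=\frac{1}{2^n\,n!}\,\frac{d^n}{dt^n}(t^2-1)^n .$$ Then for every $n\ge 0$ the function $fP_n$ is integrable on $(-1,1)$, so that the Legendre coefficients $$c_n=\frac{2n+1}{2}\int_{-1}^{1} f(t)\,P_n(t)\,dt$$ are well defined, and there is a constant $C$, depending on $f$ but not on $n$, such that $$|c_n|\le \frac{C}{n^{1/2}}\qquad\text{for all } n\ge 1 .$$ -/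

import Mathlib

open MeasureTheory Set Polynomial
open scoped ContDiff Nat

/-- The Legendre polynomial `P_n`, by Rodrigues' formula
`P_n = 1 / (2 ^ n * n!) * (d/dX)^n (X ^ 2 - 1) ^ n`. -/
noncomputable def legendrePoly (n : ℕ) : ℝ[X] :=
  C (1 / ((2 : ℝ) ^ n * (n ! : ℝ))) * derivative^[n] ((X ^ 2 - 1) ^ n)

/-- The Legendre coefficient `c_n = (2 n + 1) / 2 * ∫_{-1}^{1} f(t) P_n(t) dt`. -/
noncomputable def legendreCoeff {𝕜 : Type*} [RCLike 𝕜] (f : ℝ → 𝕜) (n : ℕ) : 𝕜 :=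
  (2 * (n : 𝕜) + 1) / 2 * ∫ t in (-1 : ℝ)..1, f t * (((legendrePoly n).eval t : ℝ) : 𝕜)

/-- `g` is the (weak) derivative `df/dt` of `f` on the open interval `(a, b)`: both functions are
locally integrable there, and `∫ ψ' f = - ∫ ψ g` for every smooth `ψ` with compact support
in `(a, b)`. -/
def HasWeakDerivOnIoo {𝕜 : Type*} [RCLike 𝕜] (f g : ℝ → 𝕜) (a b : ℝ) : Prop :=
  LocallyIntegrableOn f (Ioo a b) ∧ LocallyIntegrableOn g (Ioo a b) ∧
    ∀ ψ : ℝ → ℝ, ContDiff ℝ ∞ ψ → HasCompactSupport ψ → tsupport ψ ⊆ Ioo a b →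
      ∫ t in Ioo a b, deriv ψ t • f t = -∫ t in Ioo a b, ψ t • g t

/-! The Legendre equation reads `((1 - t²) P_n')' = -n(n+1) P_n`. Since `1 - t²` vanishes at both
endpoints, integration by parts gives `n(n+1) ∫ f P_n = ∫ f' (1 - t²) P_n'` with no boundary terms,
so a bound `|(1 - t²) P_n'| ≤ √(n+1)` on `[-1, 1]` yields `|c_n| = O(n^(-1/2))`.

That bound comes from an energy which, by the differential equation, is largest at `t = 0`; there it
is computed from central binomial coefficients. The integration by parts is justified for weak
derivatives by the du Bois-Reymond lemma: `f` is almost everywhere a constant plus the primitive of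
`f'`, and Fubini treats the primitive. -/

/-! ### The Legendre differential equation -/

/-- `y = (X ^ 2 - 1) ^ n` satisfies `(X ^ 2 - 1) y' = 2 n X y`; this is that equation
differentiated `k + 1` times. -/
theorem iterate_derivative_X_sq_sub_one_pow (n k : ℕ) :
    (X ^ 2 - 1) * derivative^[k + 2] ((X ^ 2 - 1 : ℝ[X]) ^ n)
      + (2 * (k : ℝ[X]) + 2) * X * derivative^[k + 1] ((X ^ 2 - 1 : ℝ[X]) ^ n)
      + (k : ℝ[X]) * ((k : ℝ[X]) + 1) * derivative^[k] ((X ^ 2 - 1 : ℝ[X]) ^ n)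
    = 2 * (n : ℝ[X]) * X * derivative^[k + 1] ((X ^ 2 - 1 : ℝ[X]) ^ n)
      + 2 * (n : ℝ[X]) * ((k : ℝ[X]) + 1) * derivative^[k] ((X ^ 2 - 1 : ℝ[X]) ^ n) := by
  induction k with
  | zero =>
    have h : (X ^ 2 - 1) * derivative ((X ^ 2 - 1 : ℝ[X]) ^ n)
        = 2 * (n : ℝ[X]) * X * (X ^ 2 - 1 : ℝ[X]) ^ n := by
      rcases n with _ | n
      · simp
      · simp only [derivative_pow_succ, derivative_sub, derivative_one]
        simp
        ring
    have h' := congrArg derivative h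
    simp only [derivative_mul, derivative_sub, derivative_X_pow, derivative_one, derivative_X,
      derivative_natCast, derivative_ofNat] at h'
    simp only [zero_add, Function.iterate_succ, Function.iterate_zero, Function.comp_apply, id,
      Nat.cast_zero] at h' ⊢
    simp [show (C 2 : ℝ[X]) = 2 from rfl] at h'
    linear_combination h'
  | succ k ih =>
    have h' := congrArg derivative ih
    simp only [derivative_mul, derivative_add, derivative_sub, derivative_X_pow, derivative_one,
      derivative_X, derivative_natCast, derivative_ofNat,
      ← Function.iterate_succ_apply' derivative] at h'
    simp [show (C 2 : ℝ[X]) = 2 from rfl] at h'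
    push_cast
    rw [show k + 1 + 2 = k + 2 + 1 by ring, show k + 1 + 1 = k + 2 by ring]
    simp only [Function.iterate_succ_apply] at h' ⊢
    linear_combination h'

/-- The Legendre differential equation. -/
theorem legendrePoly_ode (n : ℕ) :
    derivative ((1 - X ^ 2) * derivative (legendrePoly n))
      = -((n : ℝ[X]) * ((n : ℝ[X]) + 1)) * legendrePoly n := by
  -- At `k = n` the first-order terms combine to `2 X y^(n+1)` and the zeroth-order ones to `-n(n+1)
  -- y^(n)`.
  have h := iterate_derivative_X_sq_sub_one_pow n n
  rw [legendrePoly]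
  generalize 1 / ((2 : ℝ) ^ n * (n ! : ℝ)) = c
  simp only [derivative_mul, derivative_C, derivative_sub, derivative_one, derivative_X_pow,
    Function.iterate_succ_apply'] at h ⊢
  simp [show (C 2 : ℝ[X]) = 2 from rfl]
  linear_combination (-C c) * h

/-! ### Values at the origin and the energy bound -/

theorem coeff_X_sq_sub_one_pow_two_mul (n k : ℕ) :
    ((X ^ 2 - 1 : ℝ[X]) ^ n).coeff (2 * k) = (-1) ^ (n - k) * n.choose k := by
  have h : (X ^ 2 - 1 : ℝ[X]) ^ n = expand ℝ 2 ((X + C (-1)) ^ n) := by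
    simp [sub_eq_add_neg]
  rw [h, mul_comm 2 k, coeff_expand_mul two_pos, coeff_X_add_C_pow]

theorem coeff_X_sq_sub_one_pow_two_mul_add_one (n k : ℕ) :
    ((X ^ 2 - 1 : ℝ[X]) ^ n).coeff (2 * k + 1) = 0 := by
  have h : (X ^ 2 - 1 : ℝ[X]) ^ n = expand ℝ 2 ((X + C (-1)) ^ n) := by
    simp [sub_eq_add_neg]
  rw [h, coeff_expand two_pos, if_neg (by omega)]

theorem coeff_legendrePoly (n k : ℕ) :
    (legendrePoly n).coeff k = 1 / ((2 : ℝ) ^ n * (n ! : ℝ))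
      * ((k + n).descFactorial n * ((X ^ 2 - 1 : ℝ[X]) ^ n).coeff (k + n)) := by
  rw [legendrePoly, coeff_C_mul, coeff_iterate_derivative, nsmul_eq_mul]

/-- The induction step reduces to `(2k+1)(2k+3) ≤ (2k+2)²`. -/
theorem two_mul_add_one_mul_centralBinom_sq_le (k : ℕ) :
    (2 * k + 1) * k.centralBinom ^ 2 ≤ 16 ^ k := by
  induction k with
  | zero => simp
  | succ k ih =>
    have h := Nat.succ_mul_centralBinom_succ k
    have h2 : (k + 1) ^ 2 * ((2 * (k + 1) + 1) * (k + 1).centralBinom ^ 2)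
        ≤ (k + 1) ^ 2 * 16 ^ (k + 1) := by
      calc (k + 1) ^ 2 * ((2 * (k + 1) + 1) * (k + 1).centralBinom ^ 2)
          = (2 * (k + 1) + 1) * ((k + 1) * (k + 1).centralBinom) ^ 2 := by ring
        _ = (4 * ((2 * k + 3) * (2 * k + 1))) * ((2 * k + 1) * k.centralBinom ^ 2) := by
          rw [h]; ring
        _ ≤ (16 * (k + 1) ^ 2) * 16 ^ k := Nat.mul_le_mul (by nlinarith) ih
        _ = (k + 1) ^ 2 * 16 ^ (k + 1) := by ring
    exact Nat.le_of_mul_le_mul_left h2 (by positivity)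

/-- By parity one of `P_n(0)`, `P_n'(0)` vanishes; the other is, up to sign, `centralBinom m / 4^m`
for `n = 2m`, and `(n+1) centralBinom (m+1) / 4^(m+1)` for `n = 2m+1`. -/
theorem legendrePoly_energy_zero_le (n : ℕ) :
    (legendrePoly n).coeff 1 ^ 2 + n * (n + 1) * (legendrePoly n).coeff 0 ^ 2 ≤ (n : ℝ) + 1 := by
  rcases Nat.even_or_odd' n with ⟨m, rfl | rfl⟩
  · have hb : (2 * (m : ℝ) + 1) * (m.centralBinom : ℝ) ^ 2 ≤ 16 ^ m := by
      exact_mod_cast two_mul_add_one_mul_centralBinom_sq_le m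
    have h1 : (legendrePoly (2 * m)).coeff 1 = 0 := by
      rw [coeff_legendrePoly, add_comm 1, coeff_X_sq_sub_one_pow_two_mul_add_one]; simp
    have h0 : (legendrePoly (2 * m)).coeff 0 ^ 2 = (m.centralBinom : ℝ) ^ 2 / 16 ^ m := by
      rw [coeff_legendrePoly, zero_add, coeff_X_sq_sub_one_pow_two_mul, Nat.descFactorial_self,
        ← Nat.centralBinom_eq_two_mul_choose, pow_mul, show (16 : ℝ) ^ m = ((2 ^ 2) ^ m) ^ 2 by
          rw [← pow_mul, mul_comm, pow_mul]; norm_num]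
      have : ((2 * m)! : ℝ) ≠ 0 := by positivity
      field_simp
      rw [← pow_mul, mul_comm _ 2, pow_mul]; norm_num
    rw [h1, h0]
    push_cast
    have : (2 * (m : ℝ) + 1) * ((m.centralBinom : ℝ) ^ 2 / 16 ^ m) ≤ 1 := by
      rw [← mul_div_assoc]; exact div_le_one_of_le₀ hb (by positivity)
    nlinarith [Nat.cast_nonneg (α := ℝ) m]
  · have hb : (2 * (m : ℝ) + 3) * ((m + 1).centralBinom : ℝ) ^ 2 ≤ 16 ^ (m + 1) := by
      have := two_mul_add_one_mul_centralBinom_sq_le (m + 1)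
      rw [show 2 * (m + 1) + 1 = 2 * m + 3 by ring] at this
      exact_mod_cast this
    have h0 : (legendrePoly (2 * m + 1)).coeff 0 = 0 := by
      rw [coeff_legendrePoly, zero_add, coeff_X_sq_sub_one_pow_two_mul_add_one]; simp
    have hc : ((m + 1).centralBinom : ℝ) = 2 * ((2 * m + 1).choose (m + 1)) := by
      rw [Nat.centralBinom_eq_two_mul_choose, show 2 * (m + 1) = (2 * m + 1) + 1 by ring,
        Nat.choose_succ_succ, Nat.choose_symm_half]
      push_cast; ring
    have hd : ((1 + (2 * m + 1)).descFactorial (2 * m + 1) : ℝ)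
        = (2 * m + 2) * ((2 * m + 1)! : ℝ) := by
      have := Nat.factorial_mul_descFactorial (n := 1 + (2 * m + 1)) (k := 2 * m + 1) (by omega)
      rw [Nat.add_sub_cancel, Nat.factorial_one, one_mul, add_comm 1, Nat.factorial_succ] at this
      rw [add_comm 1, this]; push_cast; ring
    have h1 : (legendrePoly (2 * m + 1)).coeff 1 ^ 2
        = (2 * m + 2) ^ 2 * (((m + 1).centralBinom : ℝ) ^ 2 / 16 ^ (m + 1)) := by
      rw [coeff_legendrePoly, hd, show 1 + (2 * m + 1) = 2 * (m + 1) by ring,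
        coeff_X_sq_sub_one_pow_two_mul, hc, show (16 : ℝ) ^ (m + 1) = (2 * 2 ^ (2 * m + 1)) ^ 2 by
          rw [← pow_succ', show 2 * m + 1 + 1 = 2 * (m + 1) by ring, ← pow_mul,
            show 2 * (m + 1) * 2 = 4 * (m + 1) by ring, pow_mul]; norm_num]
      have : ((2 * m + 1)! : ℝ) ≠ 0 := by positivity
      field_simp
      rw [← pow_mul, mul_comm _ 2, pow_mul]; norm_num
    rw [h1, h0]
    push_cast
    have : (2 * (m : ℝ) + 3) * (((m + 1).centralBinom : ℝ) ^ 2 / 16 ^ (m + 1)) ≤ 1 := by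
      rw [← mul_div_assoc]; exact div_le_one_of_le₀ hb (by positivity)
    have h3 : (0 : ℝ) ≤ ((m + 1).centralBinom : ℝ) ^ 2 / 16 ^ (m + 1) := by positivity
    nlinarith [Nat.cast_nonneg (α := ℝ) m]

/-- In the derivative of the energy `V` the cross terms cancel by the differential equation, leaving
`V' = -2n(n+1) t P_n²`. Hence `V` increases up to `0` and decreases afterwards. -/
theorem sq_one_sub_sq_mul_derivative_legendrePoly_le (n : ℕ) {t : ℝ} (ht : t ∈ Icc (-1 : ℝ) 1) :
    (((1 - X ^ 2) * derivative (legendrePoly n)).eval t) ^ 2 ≤ (n : ℝ) + 1 := by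
  set w := legendrePoly n with hw
  set V : ℝ[X] := ((1 - X ^ 2) * derivative w) ^ 2
    + (n : ℝ[X]) * ((n : ℝ[X]) + 1) * ((1 - X ^ 2) * w ^ 2) with hV
  have hdV : derivative V = -(2 * ((n : ℝ[X]) * ((n : ℝ[X]) + 1)) * X * w ^ 2) := by
    have h := legendrePoly_ode n
    rw [← hw] at h
    rw [hV, derivative_add, derivative_pow, h]
    simp only [derivative_mul, derivative_add, derivative_sub, derivative_pow, derivative_one,
      derivative_X, derivative_natCast]
    simp [show (C 2 : ℝ[X]) = 2 from rfl]
    ring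
  have hderiv : ∀ x, deriv (fun t => V.eval t) x = -(2 * (n * (n + 1)) * x * w.eval x ^ 2) := by
    intro x
    rw [Polynomial.deriv, hdV]; simp
  have hle : V.eval t ≤ V.eval 0 := by
    rcases le_total 0 t with h | h
    · have hanti : AntitoneOn (fun t => V.eval t) (Ici 0) := by
        refine antitoneOn_of_deriv_nonpos (convex_Ici 0) V.continuousOn
          V.differentiable.differentiableOn fun x hx => ?_
        rw [interior_Ici] at hx
        have : 0 ≤ x := le_of_lt hx
        rw [hderiv, neg_nonpos]; positivity
      exact hanti (mem_Ici.2 le_rfl) h h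
    · have hmono : MonotoneOn (fun t => V.eval t) (Iic 0) := by
        refine monotoneOn_of_deriv_nonneg (convex_Iic 0) V.continuousOn
          V.differentiable.differentiableOn fun x hx => ?_
        rw [interior_Iic] at hx
        have : 0 ≤ -x := neg_nonneg.2 (le_of_lt hx)
        rw [hderiv, show -(2 * ((n : ℝ) * (n + 1)) * x * w.eval x ^ 2)
          = 2 * ((n : ℝ) * (n + 1)) * (-x) * w.eval x ^ 2 by ring]
        positivity
      exact hmono h (mem_Iic.2 le_rfl) h
  have h0 : V.eval 0 = w.coeff 1 ^ 2 + n * (n + 1) * w.coeff 0 ^ 2 := by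
    have : (derivative w).eval 0 = w.coeff 1 := by
      rw [← coeff_zero_eq_eval_zero, coeff_derivative]; simp
    simp [hV, this, coeff_zero_eq_eval_zero]
  have ht' : 0 ≤ 1 - t ^ 2 := by nlinarith [ht.1, ht.2]
  have h1 : (((1 - X ^ 2) * derivative w).eval t) ^ 2 ≤ V.eval t := by
    have : 0 ≤ (n : ℝ) * (n + 1) * ((1 - t ^ 2) * w.eval t ^ 2) := by positivity
    simpa [hV] using this
  calc _ ≤ _ := h1
    _ ≤ _ := hle
    _ ≤ _ := h0.trans_le (legendrePoly_energy_zero_le n)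

/-! ### Weak derivatives and integration by parts -/

section WeakDerivative

variable {E : Type*} [NormedAddCommGroup E] [NormedSpace ℝ E] [CompleteSpace E]

/-- Integration by parts of a `C¹` function against a primitive of an integrable function. -/
theorem integral_deriv_smul_primitive {a b : ℝ} {ρ : ℝ → ℝ} (hρ : ContDiff ℝ 1 ρ)
    {g : ℝ → E} (hg : IntegrableOn g (Ioc a b)) :
    ∫ t in Ioc a b, deriv ρ t • ∫ s in a..t, g s = ∫ s in Ioc a b, (ρ b - ρ s) • g s := by
  have hρ' : Continuous (deriv ρ) := hρ.continuous_deriv le_rfl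
  have hρi : IntegrableOn (deriv ρ) (Ioc a b) := hρ'.integrableOn_Ioc
  -- The integrand on the triangle `s ≤ t`, to which Fubini is applied.
  let G : ℝ → ℝ → E := fun t s => {p : ℝ × ℝ | p.2 ≤ p.1}.indicator
    (fun p => deriv ρ p.1 • g p.2) (t, s)
  have hG : Integrable (Function.uncurry G)
      ((volume.restrict (Ioc a b)).prod (volume.restrict (Ioc a b))) :=
    (hρi.smul_prod hg).indicator (measurableSet_le measurable_snd measurable_fst)
  have h1 : ∀ t ∈ Ioc a b, deriv ρ t • ∫ s in a..t, g s = ∫ s in Ioc a b, G t s := by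
    intro t ht
    have : ∀ s, G t s = (Iic t).indicator (fun s => deriv ρ t • g s) s := fun s => by
      simp [G, indicator_apply]
    simp_rw [this]
    rw [setIntegral_indicator measurableSet_Iic, Ioc_inter_Iic, min_eq_right ht.2, integral_smul,
      intervalIntegral.integral_of_le ht.1.le]
  have h2 : ∀ s ∈ Ioc a b, ∫ t in Ioc a b, G t s = (ρ b - ρ s) • g s := by
    intro s hs
    have : ∀ t, G t s = (Ici s).indicator (fun t => deriv ρ t • g s) t := fun t => by
      simp [G, indicator_apply]
    simp_rw [this]
    have hset : Ioc a b ∩ Ici s = Icc s b := by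
      ext x; simp only [mem_inter_iff, mem_Ioc, mem_Ici, mem_Icc]
      exact ⟨fun h => ⟨h.2, h.1.2⟩, fun h => ⟨⟨hs.1.trans_le h.1, h.2⟩, h.1⟩⟩
    rw [setIntegral_indicator measurableSet_Ici, hset, integral_Icc_eq_integral_Ioc,
      integral_smul_const, ← intervalIntegral.integral_of_le hs.2,
      intervalIntegral.integral_deriv_eq_sub (fun x _ => (hρ.differentiable one_ne_zero) x)
        (hρ'.intervalIntegrable _ _)]
  rw [setIntegral_congr_fun measurableSet_Ioc h1, integral_integral_swap hG,
    setIntegral_congr_fun measurableSet_Ioc h2]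

theorem exists_Icc_of_isCompact_subset_Ioo {a b : ℝ} (hab : a < b) {K : Set ℝ} (hK : IsCompact K)
    (hKab : K ⊆ Ioo a b) : ∃ c d, a < c ∧ d < b ∧ K ⊆ Icc c d := by
  -- The midpoint is adjoined so that the infimum and supremum are attained even when `K` is empty.
  have hm : (a + b) / 2 ∈ Ioo a b := ⟨by linarith, by linarith⟩
  have hK' : IsCompact (insert ((a + b) / 2) K) := hK.insert _
  have hne : (insert ((a + b) / 2) K).Nonempty := insert_nonempty _ _
  have hsub : insert ((a + b) / 2) K ⊆ Ioo a b := insert_subset hm hKab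
  exact ⟨_, _, (hsub (hK'.sInf_mem hne)).1, (hsub (hK'.sSup_mem hne)).2, fun x hx =>
    ⟨csInf_le hK'.bddBelow (mem_insert_of_mem _ hx), le_csSup hK'.bddAbove (mem_insert_of_mem _ hx)⟩⟩

/-- A test function with vanishing integral is the derivative of a test function. -/
theorem exists_deriv_eq_of_integral_eq_zero {a b : ℝ} (hab : a < b) {θ : ℝ → ℝ}
    (hθ : ContDiff ℝ ∞ θ) (hc : HasCompactSupport θ) (hs : tsupport θ ⊆ Ioo a b)
    (h0 : ∫ t, θ t = 0) :
    ∃ ψ : ℝ → ℝ, ContDiff ℝ ∞ ψ ∧ HasCompactSupport ψ ∧ tsupport ψ ⊆ Ioo a b ∧ deriv ψ = θ := by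
  obtain ⟨c, d, hac, hdb, hcd⟩ := exists_Icc_of_isCompact_subset_Ioo hab hc hs
  have hzero : ∀ x ∉ Icc c d, θ x = 0 := fun x hx => image_eq_zero_of_notMem_tsupport
    (fun h => hx (hcd h))
  -- This primitive vanishes left of `c` because `θ` does, and right of `d` because `θ` has total
  -- integral zero.
  let ψ : ℝ → ℝ := fun x => ∫ t in a..x, θ t
  have hd : ∀ x, HasDerivAt ψ (θ x) x := fun x => hθ.continuous.integral_hasStrictDerivAt a x |>.hasDerivAt
  have hderiv : deriv ψ = θ := funext fun x => (hd x).deriv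
  have hab0 : ∫ t in a..b, θ t = 0 := by
    rw [intervalIntegral.integral_of_le hab.le, setIntegral_eq_integral_of_forall_compl_eq_zero, h0]
    intro x hx
    exact hzero x fun h => hx ⟨hac.trans_le h.1, h.2.trans hdb.le⟩
  have hψ0 : ∀ x ∉ Icc c d, ψ x = 0 := by
    intro x hx
    rcases lt_or_ge x c with h | h
    · refine (intervalIntegral.integral_congr (g := fun _ => (0 : ℝ)) fun t ht => ?_).trans (by simp)
      refine hzero t fun h' => ?_
      have := ht.2
      exact absurd h'.1 (not_le.2 (this.trans_lt (max_lt hac h)))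
    · have hx' : d < x := lt_of_not_ge fun h' => hx ⟨h, h'⟩
      have : ψ x = (∫ t in a..b, θ t) + ∫ t in b..x, θ t :=
        (intervalIntegral.integral_add_adjacent_intervals (hθ.continuous.intervalIntegrable _ _)
          (hθ.continuous.intervalIntegrable _ _)).symm
      rw [this, hab0, zero_add]
      refine (intervalIntegral.integral_congr (g := fun _ => (0 : ℝ)) fun t ht => ?_).trans (by simp)
      refine hzero t fun h' => ?_
      have := ht.1
      exact absurd h'.2 (not_le.2 ((lt_min hdb hx').trans_le this))
  have hsupp : tsupport ψ ⊆ Icc c d := closure_minimal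
    (fun x hx => by_contra fun h => hx (hψ0 x h)) isClosed_Icc
  refine ⟨ψ, ?_, isCompact_Icc.of_isClosed_subset (isClosed_tsupport _) hsupp,
    hsupp.trans fun x hx => ⟨hac.trans_le hx.1, hx.2.trans_lt hdb⟩, hderiv⟩
  rw [contDiff_infty_iff_deriv, hderiv]
  exact ⟨fun x => (hd x).differentiableAt, hθ⟩

/-- The du Bois-Reymond lemma: a locally integrable function on an interval whose weak derivative
vanishes is almost everywhere constant. -/
theorem ae_eq_const_of_integral_deriv_smul_eq_zero {a b : ℝ} (hab : a < b) {h : ℝ → E}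
    (hh : LocallyIntegrableOn h (Ioo a b))
    (h0 : ∀ ψ : ℝ → ℝ, ContDiff ℝ ∞ ψ → HasCompactSupport ψ → tsupport ψ ⊆ Ioo a b →
      ∫ t in Ioo a b, deriv ψ t • h t = 0) :
    ∃ c : E, ∀ᵐ t, t ∈ Ioo a b → h t = c := by
  -- The outer radius `(b - a) / 3` is below half the length, which keeps the support inside the
  -- interval.
  let β : ContDiffBump ((a + b) / 2) := ⟨(b - a) / 6, (b - a) / 3, by linarith, by linarith⟩
  let ρ₀ : ℝ → ℝ := β.normed volume
  have hρ₀ : ContDiff ℝ ∞ ρ₀ := β.contDiff_normed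
  have hρ₀c : HasCompactSupport ρ₀ := β.hasCompactSupport_normed
  have hρ₀s : tsupport ρ₀ ⊆ Ioo a b := by
    rw [β.tsupport_normed_eq, Real.closedBall_eq_Icc]
    exact fun x hx => ⟨by have := hx.1; dsimp [β] at this; linarith,
      by have := hx.2; dsimp [β] at this; linarith⟩
  have hρ₀i : ∫ t, ρ₀ t = 1 := β.integral_normed
  have hint : ∀ {k : ℝ → E} {ρ : ℝ → ℝ}, LocallyIntegrableOn k (Ioo a b) → Continuous ρ →
      HasCompactSupport ρ → tsupport ρ ⊆ Ioo a b → Integrable (fun t => ρ t • k t) := by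
    intro k ρ hk hρ hc hs
    have h1 : IntegrableOn (fun t => ρ t • k t) (tsupport ρ) :=
      (hk.integrableOn_compact_subset hs hc).continuousOn_smul hρ.continuousOn hc
    refine (integrableOn_iff_integrable_of_support_subset fun x hx => ?_).1 h1
    exact subset_tsupport ρ fun h => hx (by simp [h])
  refine ⟨∫ t, ρ₀ t • h t, ?_⟩
  set c : E := ∫ t, ρ₀ t • h t with hcdef
  have hconst : LocallyIntegrableOn (fun _ : ℝ => c) (Ioo a b) :=
    (locallyIntegrable_const c).locallyIntegrableOn _
  have key : ∀ᵐ t, t ∈ Ioo a b → h t - c = 0 := by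
    refine isOpen_Ioo.ae_eq_zero_of_integral_contDiff_smul_eq_zero (hh.sub hconst) ?_
    intro ρ hρ hρc hρs
    set I := ∫ t, ρ t with hI
    have hρint : Integrable ρ := hρ.continuous.integrable_of_hasCompactSupport hρc
    have hρ₀int : Integrable ρ₀ := hρ₀.continuous.integrable_of_hasCompactSupport hρ₀c
    -- Subtracting `I * ρ₀` makes the integral zero, so `θ` is the derivative of a test function and
    -- `h0` applies.
    let θ : ℝ → ℝ := fun t => ρ t - I * ρ₀ t
    have hθs : tsupport θ ⊆ tsupport ρ ∪ tsupport ρ₀ := by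
      refine closure_minimal (fun x hx => ?_) ((isClosed_tsupport _).union (isClosed_tsupport _))
      by_contra hcon
      rw [mem_union, not_or] at hcon
      exact hx (by simp [θ, image_eq_zero_of_notMem_tsupport hcon.1,
        image_eq_zero_of_notMem_tsupport hcon.2])
    have hθc : HasCompactSupport θ :=
      (hρc.isCompact.union hρ₀c.isCompact).of_isClosed_subset (isClosed_tsupport _) hθs
    have hθ0 : ∫ t, θ t = 0 := by
      rw [integral_sub hρint (hρ₀int.const_mul I), integral_const_mul, hρ₀i]; simp [hI]
    obtain ⟨ψ, hψ, hψc, hψs, hψd⟩ := exists_deriv_eq_of_integral_eq_zero hab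
      (hρ.sub (contDiff_const.mul hρ₀)) hθc (hθs.trans (union_subset hρs hρ₀s)) hθ0
    have hz := h0 ψ hψ hψc hψs
    rw [hψd, setIntegral_eq_integral_of_forall_compl_eq_zero] at hz
    · have e1 : ∫ t, θ t • h t = (∫ t, ρ t • h t) - I • c := by
        simp only [θ, sub_smul, mul_smul]
        have hi := (hint hh hρ₀.continuous hρ₀c hρ₀s).smul I
        simp only [Pi.smul_def] at hi
        rw [integral_sub (hint hh hρ.continuous hρc hρs) hi, integral_smul]
      simp_rw [smul_sub]
      rw [integral_sub (hint hh hρ.continuous hρc hρs) (hρint.smul_const c), integral_smul_const,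
        ← hI, ← e1]
      exact hz
    · intro x hx
      have : θ x = 0 := image_eq_zero_of_notMem_tsupport fun h' =>
        hx ((hθs.trans (union_subset hρs hρ₀s)) h')
      simp [θ] at this
      simp [this]
  filter_upwards [key] with t ht hmem
  exact sub_eq_zero.1 (ht hmem)

end WeakDerivative

/-- The primitive of `g` also has weak derivative `g`, so its difference with `f` has weak
derivative zero. -/
theorem HasWeakDerivOnIoo.ae_eq_const_add_primitive {𝕜 : Type*} [RCLike 𝕜] {f g : ℝ → 𝕜} {a b : ℝ}
    (hab : a < b) (hf : HasWeakDerivOnIoo f g a b) (hg : IntegrableOn g (Ioo a b)) :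
    ∃ c : 𝕜, ∀ᵐ t, t ∈ Ioo a b → f t = c + ∫ s in a..t, g s := by
  have hg' : IntegrableOn g (Ioc a b) := (integrableOn_Ioc_iff_integrableOn_Ioo).2 hg
  have hgi : IntervalIntegrable g volume a b :=
    (intervalIntegrable_iff_integrableOn_Ioc_of_le hab.le).2 hg'
  have hF : ContinuousOn (fun t => ∫ s in a..t, g s) (Icc a b) := by
    have := intervalIntegral.continuousOn_primitive_interval' hgi left_mem_uIcc
    rwa [uIcc_of_le hab.le] at this
  have hFl : LocallyIntegrableOn (fun t => ∫ s in a..t, g s) (Ioo a b) :=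
    (hF.mono Ioo_subset_Icc_self).locallyIntegrableOn measurableSet_Ioo
  obtain ⟨c, hc⟩ := ae_eq_const_of_integral_deriv_smul_eq_zero hab (hf.1.sub hFl) (by
    intro ψ hψ hψc hψs
    have hψ1 : ContDiff ℝ 1 ψ := hψ.of_le (by exact_mod_cast le_top)
    have hψ' : Continuous (deriv ψ) := hψ1.continuous_deriv le_rfl
    have hdc : HasCompactSupport (deriv ψ) := hψc.deriv
    have hds : tsupport (deriv ψ) ⊆ Ioo a b :=
      (closure_minimal (support_deriv_subset) (isClosed_tsupport _)).trans hψs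
    have hfi : IntegrableOn (fun t => deriv ψ t • f t) (Ioo a b) := by
      have h1 : IntegrableOn (fun t => deriv ψ t • f t) (tsupport (deriv ψ)) :=
        (hf.1.integrableOn_compact_subset hds hdc).continuousOn_smul hψ'.continuousOn hdc
      refine ((integrableOn_iff_integrable_of_support_subset fun x hx => ?_).1 h1).integrableOn
      exact subset_tsupport (deriv ψ) fun h => hx (by simp [h])
    have hFi : IntegrableOn (fun t => deriv ψ t • ∫ s in a..t, g s) (Ioo a b) :=
      ((hψ'.continuousOn.smul hF).integrableOn_Icc).mono_set Ioo_subset_Icc_self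
    have hb : ψ b = 0 := image_eq_zero_of_notMem_tsupport fun h => (lt_irrefl _ (hψs h).2)
    have e := integral_deriv_smul_primitive hψ1 hg'
    simp only [hb, zero_sub, neg_smul, integral_neg, integral_Ioc_eq_integral_Ioo] at e
    simp_rw [Pi.sub_apply, smul_sub]
    rw [integral_sub hfi hFi, e, hf.2.2 ψ hψ hψc hψs, sub_self])
  refine ⟨c, ?_⟩
  filter_upwards [hc] with t ht hmem
  exact sub_eq_iff_eq_add.1 (ht hmem)

/-- The representative of `f` as constant plus primitive is continuous on the closed interval. -/
theorem HasWeakDerivOnIoo.integrableOn {𝕜 : Type*} [RCLike 𝕜] {f g : ℝ → 𝕜} {a b : ℝ}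
    (hab : a < b) (hf : HasWeakDerivOnIoo f g a b) (hg : IntegrableOn g (Ioo a b)) :
    IntegrableOn f (Ioo a b) := by
  obtain ⟨c, hc⟩ := hf.ae_eq_const_add_primitive hab hg
  have hgi : IntervalIntegrable g volume a b :=
    (intervalIntegrable_iff_integrableOn_Ioo_of_le hab.le).2 hg
  have hF : ContinuousOn (fun t => c + ∫ s in a..t, g s) (Icc a b) := by
    have := intervalIntegral.continuousOn_primitive_interval' hgi left_mem_uIcc
    rw [uIcc_of_le hab.le] at this
    exact continuousOn_const.add this
  exact (hF.integrableOn_Icc.mono_set Ioo_subset_Icc_self).congr_fun_ae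
    ((ae_restrict_iff' measurableSet_Ioo).2 (hc.mono fun t ht hmem => (ht hmem).symm))

/-- The defining identity of the weak derivative extends to `C¹` functions that merely vanish at
the endpoints, when the weak derivative is integrable. -/
theorem HasWeakDerivOnIoo.integral_deriv_smul {𝕜 : Type*} [RCLike 𝕜] {f g : ℝ → 𝕜} {a b : ℝ}
    (hab : a < b) (hf : HasWeakDerivOnIoo f g a b) (hg : IntegrableOn g (Ioo a b))
    {ρ : ℝ → ℝ} (hρ : ContDiff ℝ 1 ρ) (ha : ρ a = 0) (hb : ρ b = 0) :
    ∫ t in Ioo a b, deriv ρ t • f t = -∫ t in Ioo a b, ρ t • g t := by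
  obtain ⟨c, hc⟩ := hf.ae_eq_const_add_primitive hab hg
  have hg' : IntegrableOn g (Ioc a b) := (integrableOn_Ioc_iff_integrableOn_Ioo).2 hg
  have hgi : IntervalIntegrable g volume a b :=
    (intervalIntegrable_iff_integrableOn_Ioc_of_le hab.le).2 hg'
  have hF : ContinuousOn (fun t => ∫ s in a..t, g s) (Icc a b) := by
    have := intervalIntegral.continuousOn_primitive_interval' hgi left_mem_uIcc
    rwa [uIcc_of_le hab.le] at this
  have hρ' : Continuous (deriv ρ) := hρ.continuous_deriv le_rfl
  have e : ∫ t in Ioo a b, deriv ρ t • f t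
      = ∫ t in Ioo a b, (deriv ρ t • c + deriv ρ t • ∫ s in a..t, g s) := by
    refine setIntegral_congr_ae measurableSet_Ioo (hc.mono fun t ht hmem => ?_)
    rw [ht hmem, smul_add]
  have hci : IntegrableOn (fun t => deriv ρ t • c) (Ioo a b) :=
    (hρ'.smul continuous_const).integrableOn_Icc.mono_set Ioo_subset_Icc_self
  have hFi : IntegrableOn (fun t => deriv ρ t • ∫ s in a..t, g s) (Ioo a b) :=
    (hρ'.continuousOn.smul hF).integrableOn_Icc.mono_set Ioo_subset_Icc_self
  -- The constant `c` contributes only `(ρ b - ρ a) • c`.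
  have h0 : ∫ t in Ioo a b, deriv ρ t = 0 := by
    rw [← integral_Ioc_eq_integral_Ioo, ← intervalIntegral.integral_of_le hab.le,
      intervalIntegral.integral_deriv_eq_sub (fun x _ => (hρ.differentiable one_ne_zero) x)
        (hρ'.intervalIntegrable _ _), ha, hb, sub_zero]
  have e2 := integral_deriv_smul_primitive hρ hg'
  simp only [hb, zero_sub, neg_smul, integral_neg, integral_Ioc_eq_integral_Ioo] at e2
  rw [e, integral_add hci hFi, integral_smul_const, h0, zero_smul, zero_add, e2]

/-! ### The coefficient estimate -/

theorem norm_integral_mul_legendrePoly_le {𝕜 : Type*} [RCLike 𝕜] {f f' : ℝ → 𝕜}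
    (hf : HasWeakDerivOnIoo f f' (-1) 1) (hf' : IntegrableOn f' (Ioo (-1 : ℝ) 1)) (n : ℕ) :
    (n : ℝ) * (n + 1) * ‖∫ t in (-1 : ℝ)..1, f t * (((legendrePoly n).eval t : ℝ) : 𝕜)‖
      ≤ √(n + 1) * ∫ t in Ioo (-1 : ℝ) 1, ‖f' t‖ := by
  set u : ℝ[X] := (1 - X ^ 2) * derivative (legendrePoly n) with hu
  have hIBP := hf.integral_deriv_smul (by norm_num) hf' (ρ := fun t => u.eval t)
    (by simpa using u.contDiff_aeval (𝕜 := ℝ) 1) (by simp [hu]) (by simp [hu])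
  have hderiv : ∀ t, deriv (fun t => u.eval t) t
      = -((n : ℝ) * (n + 1)) * (legendrePoly n).eval t := by
    intro t
    rw [Polynomial.deriv, hu, legendrePoly_ode]; simp
  have hL : ∫ t in Ioo (-1 : ℝ) 1, deriv (fun t => u.eval t) t • f t
      = (-((n : ℝ) * (n + 1))) •
        ∫ t in (-1 : ℝ)..1, f t * (((legendrePoly n).eval t : ℝ) : 𝕜) := by
    rw [intervalIntegral.integral_of_le (by norm_num), integral_Ioc_eq_integral_Ioo,
      ← integral_smul]
    refine setIntegral_congr_fun measurableSet_Ioo fun t _ => ?_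
    simp only [hderiv, mul_smul]
    rw [RCLike.real_smul_eq_coe_mul ((legendrePoly n).eval t), mul_comm (f t)]
  have hbound : ‖∫ t in Ioo (-1 : ℝ) 1, u.eval t • f' t‖
      ≤ √(n + 1) * ∫ t in Ioo (-1 : ℝ) 1, ‖f' t‖ := by
    rw [← integral_const_mul]
    refine norm_integral_le_of_norm_le (hf'.norm.const_mul _)
      ((ae_restrict_iff' measurableSet_Ioo).2 (.of_forall fun t ht => ?_))
    rw [norm_smul]
    gcongr
    exact Real.abs_le_sqrt
      (sq_one_sub_sq_mul_derivative_legendrePoly_le n (Ioo_subset_Icc_self ht))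
  have hnorm := congrArg norm (hL.symm.trans hIBP)
  rw [norm_neg, norm_smul, norm_neg, Real.norm_of_nonneg (by positivity)] at hnorm
  exact hnorm.trans_le hbound

theorem mainTheorem6 {𝕜 : Type*} [RCLike 𝕜] (f f' : ℝ → 𝕜)
    (hf : HasWeakDerivOnIoo f f' (-1) 1)
    (hf' : IntegrableOn f' (Ioo (-1 : ℝ) 1)) :
    (∀ n : ℕ, IntervalIntegrable
        (fun t : ℝ => f t * (((legendrePoly n).eval t : ℝ) : 𝕜)) volume (-1) 1) ∧
      ∃ C : ℝ, ∀ n : ℕ, 1 ≤ n → ‖legendreCoeff f n‖ ≤ C / (n : ℝ) ^ (1 / 2 : ℝ) := by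
  -- The factor `2` comes from `(2n+1)/2 ≤ 2n` for `n ≥ 1`, combined with `n I √n ≤ J`.
  refine ⟨fun n => ?_, 2 * ∫ t in Ioo (-1 : ℝ) 1, ‖f' t‖, fun n hn => ?_⟩
  · have hfi : IntervalIntegrable f volume (-1) 1 :=
      (intervalIntegrable_iff_integrableOn_Ioo_of_le (by norm_num)).2
        (hf.integrableOn (by norm_num) hf')
    exact hfi.mul_continuousOn
      (RCLike.continuous_ofReal.comp (legendrePoly n).continuous).continuousOn
  · have h := norm_integral_mul_legendrePoly_le hf hf' n
    set I := ‖∫ t in (-1 : ℝ)..1, f t * (((legendrePoly n).eval t : ℝ) : 𝕜)‖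
    set J := ∫ t in Ioo (-1 : ℝ) 1, ‖f' t‖
    have hJ : 0 ≤ J := integral_nonneg fun _ => norm_nonneg _
    have hI : 0 ≤ I := norm_nonneg _
    have hn' : (1 : ℝ) ≤ n := by exact_mod_cast hn
    have hc : ‖(2 * (n : 𝕜) + 1) / 2‖ = (2 * (n : ℝ) + 1) / 2 := by
      have : (2 * (n : 𝕜) + 1) / 2 = (((2 * (n : ℝ) + 1) / 2 : ℝ) : 𝕜) := by push_cast; rfl
      rw [this, RCLike.norm_ofReal, abs_of_nonneg (by positivity)]
    rw [legendreCoeff, norm_mul, hc, ← Real.sqrt_eq_rpow, le_div_iff₀ (by positivity)]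
    have hs : √(n + 1 : ℝ) * √n ≤ n + 1 := by
      calc √(n + 1 : ℝ) * √n ≤ √(n + 1 : ℝ) * √(n + 1) := by gcongr; linarith
        _ = n + 1 := Real.mul_self_sqrt (by positivity)
    have h2 : ((n : ℝ) + 1) * (n * (I * √n)) ≤ (n + 1) * J := by
      calc ((n : ℝ) + 1) * (n * (I * √n)) = (n * (n + 1) * I) * √n := by ring
        _ ≤ (√(n + 1) * J) * √n := by gcongr
        _ = (√(n + 1) * √n) * J := by ring
        _ ≤ (n + 1) * J := by gcongr
    have h3 : (n : ℝ) * (I * √n) ≤ J := le_of_mul_le_mul_left h2 (by positivity)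
    calc (2 * (n : ℝ) + 1) / 2 * I * √n = (2 * (n : ℝ) + 1) / 2 * (I * √n) := by ring
      _ ≤ 2 * n * (I * √n) := by gcongr; linarith
      _ ≤ 2 * J := by linarith
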